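/- **Conventions.** A graph consists of a set $P$ of points and a set $E$ of edges with source and target maps $s,t:E\to P$. Let $2_{\mathcal G}$ be the graph with points $V,\epsilon$ and exactly three edges $V\to\epsilon$, $\epsilon\to V$, $\epsilon\to\epsilon$. An *open-graph* is a graph $G$ with a morphism $\tau:G\to 2_{\mathcal G}$ such that every edge-point (a point of type $\epsilon$) has at most one in-edge and at most one out-edge; points of type $V$ are called vertices. A *morphism* $f$ of open-graphs is a type-preserving graph morphism that is full on vertices: for each vertex $v$, every edge adjacent to $f(v)$ lies in the image of $f$. A morphism is *mono* if it is left-cancellable with respect to morphisms of open-graphs. An *adhesive pushout* is a commutative square of morphisms of open-graphs that has the universal property of a pushout with respect to morphisms of open-graphs and is also a pushout in the slice category $\mathbf{Graph}/2_{\mathcal G}$. $\mathrm{In}(G)$ (resp. $\mathrm{Out}(G)$) is the set of edge-points of $G$ without in-edges (resp. out-edges). A *boundary map* of $G$ is a map $b:B\to G$, where $B$ has no edges, only edge-points, and its set of points is a disjoint union $B^i\sqcup B^o$ such that $b$ maps $B^i$ bijectively onto $\mathrm{In}(G)$ and $B^o$ bijectively onto $\mathrm{Out}(G)$. A *boundary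 span* $L\xleftarrow{b_1}B\xrightarrow{b_2}R$ is a pair of boundary maps for the same decomposition $B=B^i\sqcup B^o$. A *rewrite rule* $r: L\multimap R$ is a boundary span in which $b_1,b_2$ are mono; its opposite is $R\xleftarrow{b_2}B\xrightarrow{b_1}L$. Let $r$ be a rewrite rule $L\xleftarrow{b_1}B\xrightarrow{b_2}R$ and $m:L\to G$ a mono (a *matching*). Then $r$ *rewrites $G$ to $G'$ at $m$* if there are an open-graph $D$ and morphisms such that $$\begin{array}{ccc}B&\xrightarrow{b_1}&L\\ {\scriptstyle c}\downarrow&&\downarrow{\scriptstyle m}\\ D&\xrightarrow{s}&G\end{array}\qquad\begin{array}{ccc}B&\xrightarrow{b_2}&R\\ {\scriptstyle c}\downarrow&&\downarrow\\ D&\xrightarrow{s'}&G'\end{array}$$ are adhesive pushouts. The *extension* of $r$ by $m$ is the boundary span $G\xleftarrow{b_1'}B'\xrightarrow{b_2'}G'$ for which there is $k:B'\to D$ with $b_1'=sk$ and $b_2'=s'k$. It is a rewrite rule when $b_1',b_2'$ are mono, i.e. when $G$ and $G'$ have no isolated points (points that are both inputs and outputs). A span of monos $H_1\xleftarrow{k_1}K\xrightarrow{k_2}H_2$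 is *boundary coherent* if for each $p\in\mathrm{In}(K)$ at least one of $k_1(p),k_2(p)$ is an input, and for each $p\in\mathrm{Out}(K)$ at least one of $k_1(p),k_2(p)$ is an output. Its adhesive pushout $M$ is the *merging* of $H_1$ and $H_2$ by $k_1,k_2$. Given rewrite rules $r_1:L_1\multimap R_1$ and $r_2:L_2\multimap R_2$ and a boundary-coherent span $R_1\xleftarrow{k_1}K\xrightarrow{k_2}L_2$ with merging $M$, the *sequential composition* $r_1;_{k_1,k_2}r_2$ is the rewrite rule $G\xleftarrow{b_1}B\xrightarrow{b_2}G'$ (unique up to isomorphism), where the opposite of $r_1$ rewrites $M$ to $G$ at the embedding $R_1\to M$ with extension $M\xleftarrow{b}B\xrightarrow{b_1}G$, and $r_2$ rewrites $M$ to $G'$ at the embedding $L_2\to M$ with extension $M\xleftarrow{b}B\xrightarrow{b_2}G'$, for one and the same boundary map $b$ of $M$. **Theorem (Completeness).** Let $r_1:L_1\multimap R_1$ and $r_2:L_2\multimap R_2$ be rewrite rules, and let $M_1,M_2,M_3$ be open-graphs such that $r_1$ rewrites $M_1$ to $M_2$ at a matching $m_1$ and $r_2$ rewrites $M_2$ to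 $M_3$ at a matching $m_2$. Then there are a boundary-coherent span $R_1\xleftarrow{k_1}K\xrightarrow{k_2}L_2$ for which the sequential composition $r_1;_{k_1,k_2}r_2$ exists, and a matching $m'$ of its left-hand side in $M_1$, such that $r_1;_{k_1,k_2}r_2$ rewrites $M_1$ to $M_3$ at $m'$, with an extension $M_1\leftarrow C\to M_3$. If the extensions of $r_1$ by $m_1$ and of $r_2$ by $m_2$ are rewrite rules, then so is this extension. -/

import Mathlib

open CategoryTheory CategoryTheory.Limits

universe u

namespace OpenGraph

/-! ### Directed graphs -/

/-- Directed graphs as functors from `E ⇉ P` to sets: in Mathlib's walking parallel pair the object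
`zero` plays the role of `E` (edges), `one` the role of `P` (points), and the arrows `left`, `right`
are the source and target maps. Morphisms are natural transformations. -/
abbrev Graph : Type (u + 1) := WalkingParallelPair ⥤ Type u

/-- The points of a graph. -/
abbrev Graph.Point (G : Graph.{u}) : Type u := G.obj WalkingParallelPair.one

/-- The edges of a graph. -/
abbrev Graph.Edge (G : Graph.{u}) : Type u := G.obj WalkingParallelPair.zero

/-- The source of an edge. -/
abbrev Graph.src (G : Graph.{u}) (e : Graph.Edge G) : Graph.Point G :=
  G.map WalkingParallelPairHom.left e

/-- The target of an edge. -/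
abbrev Graph.tgt (G : Graph.{u}) (e : Graph.Edge G) : Graph.Point G :=
  G.map WalkingParallelPairHom.right e

/-- The points of the type graph: `V` (vertices) and `eps` (edge-points). -/
inductive TypePoint : Type u
  | V
  | eps

/-- The edges of the type graph: one `V → eps`, one `eps → V` and one loop on `eps`; there is no
loop on `V`. -/
inductive TypeEdge : Type u
  | vToEps
  | epsToV
  | epsLoop

/-- Sources in the type graph. -/
def TypeEdge.src : TypeEdge.{u} → TypePoint.{u}
  | vToEps => .V
  | epsToV => .eps
  | epsLoop => .eps

/-- Targets in the type graph. -/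
def TypeEdge.tgt : TypeEdge.{u} → TypePoint.{u}
  | vToEps => .eps
  | epsToV => .V
  | epsLoop => .eps

/-- The type graph with a vertex type `V` and an edge-point type `eps`. -/
def typeGraph : Graph.{u} :=
  parallelPair (TypeCat.ofHom TypeEdge.src.{u}) (TypeCat.ofHom TypeEdge.tgt.{u})

/-- Typed graphs: the slice category of graphs over the type graph. -/
abbrev TypedGraph : Type (u + 1) := Over typeGraph.{u}

namespace TypedGraph

/-- The points of a typed graph. -/
abbrev Point (G : TypedGraph.{u}) : Type u := Graph.Point G.left

/-- The edges of a typed graph. -/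
abbrev Edge (G : TypedGraph.{u}) : Type u := Graph.Edge G.left

/-- The source of an edge. -/
abbrev src (G : TypedGraph.{u}) (e : Edge G) : Point G := Graph.src G.left e

/-- The target of an edge. -/
abbrev tgt (G : TypedGraph.{u}) (e : Edge G) : Point G := Graph.tgt G.left e

/-- The type of a point. -/
def type (G : TypedGraph.{u}) (p : Point G) : TypePoint.{u} :=
  G.hom.app WalkingParallelPair.one p

/-- `p` is a vertex. -/
def IsVertex (G : TypedGraph.{u}) (p : Point G) : Prop := type G p = TypePoint.V

/-- `p` is an edge-point. -/
def IsEdgePoint (G : TypedGraph.{u}) (p : Point G) : Prop := type G p = TypePoint.eps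

/-- The action of a morphism on points. -/
abbrev onPoint {G H : TypedGraph.{u}} (f : G ⟶ H) (p : Point G) : Point H :=
  f.left.app WalkingParallelPair.one p

/-- The action of a morphism on edges. -/
abbrev onEdge {G H : TypedGraph.{u}} (f : G ⟶ H) (e : Edge G) : Edge H :=
  f.left.app WalkingParallelPair.zero e

/-- A morphism is full on vertices if every edge adjacent to the image of a vertex lies in the
image of the morphism. -/
def FullOnVertices {G H : TypedGraph.{u}} (f : G ⟶ H) : Prop :=
  ∀ v : Point G, IsVertex G v → ∀ e : Edge H,
    (src H e = onPoint f v ∨ tgt H e = onPoint f v) → ∃ e' : Edge G, onEdge f e' = e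

/-- Each edge-point has at most one in-edge and at most one out-edge. -/
def IsOpen (G : TypedGraph.{u}) : Prop :=
  ∀ p : Point G, IsEdgePoint G p → ∀ e e' : Edge G,
    (tgt G e = p → tgt G e' = p → e = e') ∧ (src G e = p → src G e' = p → e = e')

end TypedGraph

/-! ### Open-graphs -/

/-- An open-graph: a typed graph in which every edge-point has at most one in-edge and at most one
out-edge. -/
structure OGraph : Type (u + 1) where
  /-- The underlying typed graph. -/
  typed : TypedGraph.{u}
  isOpen : TypedGraph.IsOpen typed

/-- A morphism of open-graphs: a morphism of typed graphs that is full on vertices. Equations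
between composites are stated in the slice category. -/
@[ext]
structure OHom (G H : OGraph.{u}) : Type u where
  /-- The underlying morphism of typed graphs. -/
  hom : G.typed ⟶ H.typed
  full : TypedGraph.FullOnVertices hom

namespace OGraph

/-- The points of an open-graph. -/
abbrev Point (G : OGraph.{u}) : Type u := TypedGraph.Point G.typed

/-- The edges of an open-graph. -/
abbrev Edge (G : OGraph.{u}) : Type u := TypedGraph.Edge G.typed

/-- The inputs: edge-points without in-edges. -/
def inputs (G : OGraph.{u}) : Set G.Point :=
  {p | TypedGraph.IsEdgePoint G.typed p ∧ ∀ e : G.Edge, TypedGraph.tgt G.typed e ≠ p}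

/-- The outputs: edge-points without out-edges. -/
def outputs (G : OGraph.{u}) : Set G.Point :=
  {p | TypedGraph.IsEdgePoint G.typed p ∧ ∀ e : G.Edge, TypedGraph.src G.typed e ≠ p}

/-- A point-graph consists of isolated points only: every point is both an input and an output. -/
def IsPointGraph (G : OGraph.{u}) : Prop := ∀ p : G.Point, p ∈ G.inputs ∧ p ∈ G.outputs

end OGraph

namespace OHom

/-- The action of an open-graph morphism on points. -/
abbrev onPoint {G H : OGraph.{u}} (f : OHom G H) (p : G.Point) : H.Point :=
  TypedGraph.onPoint f.hom p

/-- Monomorphisms of open-graphs: left-cancellable with respect to open-graph morphisms. -/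
def IsMono {G H : OGraph.{u}} (f : OHom G H) : Prop :=
  ∀ (X : OGraph.{u}) (g h : OHom X G), g.hom ≫ f.hom = h.hom ≫ f.hom → g = h

end OHom

/-- An adhesive pushout: a commutative square of open-graph morphisms that is a pushout among
open-graphs and whose image in the slice category of typed graphs is a pushout as well. -/
structure IsAdhesivePushout {A B C D : OGraph.{u}} (f : OHom A B) (g : OHom A C)
    (i : OHom B D) (j : OHom C D) : Prop where
  universal : ∀ (X : OGraph.{u}) (p : OHom B X) (q : OHom C X),
    f.hom ≫ p.hom = g.hom ≫ q.hom →
      ∃! v : OHom D X, i.hom ≫ v.hom = p.hom ∧ j.hom ≫ v.hom = q.hom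
  slice : IsPushout f.hom g.hom i.hom j.hom

/-! ### Boundaries and rewrite rules -/

/-- `b : B ⟶ G` presents `B` as the coproduct `In(G) + Out(G)` with its canonical map to `G`:
`B` is a point-graph, the points in `ins` form the summand `In(G)`, and the remaining points the
summand `Out(G)`. -/
structure IsBoundaryMap {B G : OGraph.{u}} (b : OHom B G) (ins : Set B.Point) : Prop where
  pointGraph : B.IsPointGraph
  bij_inputs : Set.BijOn b.onPoint ins G.inputs
  bij_outputs : Set.BijOn b.onPoint insᶜ G.outputs

/-- A span `L ⟵ B ⟶ R` by which `L` and `R` share the same boundary `B`: both legs are boundary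
maps, for one and the same splitting of `B` into inputs and outputs. -/
structure BoundarySpan (L B R : OGraph.{u}) : Type u where
  /-- The boundary map of the left-hand side. -/
  left : OHom B L
  /-- The boundary map of the right-hand side. -/
  right : OHom B R
  /-- The points of `B` that stand for inputs. -/
  ins : Set B.Point
  isBoundary_left : IsBoundaryMap left ins
  isBoundary_right : IsBoundaryMap right ins

/-- A boundary span is a rewrite rule when both legs are monomorphisms. -/
def BoundarySpan.IsRule {L B R : OGraph.{u}} (e : BoundarySpan L B R) : Prop :=
  e.left.IsMono ∧ e.right.IsMono

/-- A rewrite rule `L ⊸ R` with boundary `B`. -/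
structure RewriteRule (L B R : OGraph.{u}) : Type u extends BoundarySpan L B R where
  isRule : toBoundarySpan.IsRule

/-- The opposite rewrite rule `R ⊸ L`. -/
def RewriteRule.op {L B R : OGraph.{u}} (r : RewriteRule L B R) : RewriteRule R B L where
  left := r.right
  right := r.left
  ins := r.ins
  isBoundary_left := r.isBoundary_right
  isBoundary_right := r.isBoundary_left
  isRule := ⟨r.isRule.2, r.isRule.1⟩

/-- `r` rewrites `G` to `G'` at the matching `m : L ⟶ G`, and the boundary span `e` between `G`
and `G'` is the extension of `r` by `m`. That is, `m` is mono, and there are a graph `D` (the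
subtraction of `L` from `G`) and a double pushout
```
  L ⟵ B ⟶ R
  m↓    c↓    ↓n
  G ⟵ D ⟶ G'
     s     s'
```
of adhesive pushouts, such that `e.left` and `e.right` factor through `s` and `s'` by one and the
same map `k : B' ⟶ D`. -/
def IsExtension {L B R G B' G' : OGraph.{u}} (r : RewriteRule L B R) (m : OHom L G)
    (e : BoundarySpan G B' G') : Prop :=
  m.IsMono ∧
  ∃ (D : OGraph.{u}) (c : OHom B D) (s : OHom D G) (n : OHom R G') (s' : OHom D G'),
    IsAdhesivePushout r.left c m s ∧
    IsAdhesivePushout r.right c n s' ∧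
    ∃ k : OHom B' D, k.hom ≫ s.hom = e.left.hom ∧ k.hom ≫ s'.hom = e.right.hom

/-! ### Merging and sequential composition -/

/-- A span `H₁ ⟵ K ⟶ H₂` of monomorphisms is boundary coherent if every input of `K` stays an
input under at least one leg and every output of `K` stays an output under at least one leg. -/
structure IsBoundaryCoherent {K H₁ H₂ : OGraph.{u}} (f : OHom K H₁) (g : OHom K H₂) : Prop where
  mono_left : f.IsMono
  mono_right : g.IsMono
  inputs : ∀ p ∈ K.inputs, f.onPoint p ∈ H₁.inputs ∨ g.onPoint p ∈ H₂.inputs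
  outputs : ∀ p ∈ K.outputs, f.onPoint p ∈ H₁.outputs ∨ g.onPoint p ∈ H₂.outputs

/-- `M`, with the embeddings `i₁`, `i₂`, is the merging of `G₁` and `G₂` on `K` by the
boundary-coherent span `k₁`, `k₂`. -/
def IsMerging {K G₁ G₂ M : OGraph.{u}} (k₁ : OHom K G₁) (k₂ : OHom K G₂)
    (i₁ : OHom G₁ M) (i₂ : OHom G₂ M) : Prop :=
  IsBoundaryCoherent k₁ k₂ ∧ IsAdhesivePushout k₁ k₂ i₁ i₂

/-- The rule `q : G ⊸ G'` is the sequential composition of `r₁ : L₁ ⊸ R₁` and `r₂ : L₂ ⊸ R₂` at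
`k₁ : K ⟶ R₁`, `k₂ : K ⟶ L₂`: for the merging `M` of `R₁` and `L₂`, the graph `G` arises from `M`
by the opposite of `r₁` at the embedding of `R₁`, the graph `G'` arises from `M` by `r₂` at the
embedding of `L₂`, and the boundary maps of `q` are those of the two extensions `e₁`, `e₂`, which
share the boundary map of `M`. -/
def IsSeqComp {L₁ B₁ R₁ L₂ B₂ R₂ K G B G' : OGraph.{u}}
    (r₁ : RewriteRule L₁ B₁ R₁) (r₂ : RewriteRule L₂ B₂ R₂)
    (k₁ : OHom K R₁) (k₂ : OHom K L₂) (q : RewriteRule G B G') : Prop :=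
  ∃ (M : OGraph.{u}) (i₁ : OHom R₁ M) (i₂ : OHom L₂ M)
    (e₁ : BoundarySpan M B G) (e₂ : BoundarySpan M B G'),
    IsMerging k₁ k₂ i₁ i₂ ∧
    IsExtension r₁.op i₁ e₁ ∧ IsExtension r₂ i₂ e₂ ∧
    e₁.left = e₂.left ∧ e₁.ins = e₂.ins ∧
    q.left = e₁.right ∧ q.right = e₂.right ∧ q.ins = e₁.ins

end OpenGraph

/-! Everything takes place inside $M_2$. Rule boundaries have no edges, and monos separate
edge-points, so the squares of a double pushout at a mono matching are unions of subgraphs glued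
along their intersection (`IsUnion`); gluing arguments become elementwise set theory.

The images of $R_1$ and $L_2$ in $M_2$ meet in $K$. This span is boundary coherent: edges of $R_1$
and $L_2$ with the same end at a common edge-point coincide by openness, so they lie in $K$. The
union $M$ of the two images is the merging (`exists_merging`). Let $D_0$ be what lies outside $M$,
with the boundary of $M$ added (`OHom.exists_complement`). Each rewrite changes only the interior of
$M$: the opposite of $r_1$ turns $M$ into some $G$, $r_2$ turns $M$ into some $G'$, and $M_1 = G
\cup D_0$, $M_3 = G' \cup D_0$, glued along the boundary of $M$ (`exists_restriction`). These two
unions are the double pushout of the composite rule $G \multimap G'$, with context $D_0$. -/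

namespace OpenGraph

/-! ### Free ends of edge-points, injective morphisms and factorisation -/

namespace OGraph

/-- The edge-points that are not the `φ`-end of any edge: the inputs if `φ` is the target map, the
outputs if `φ` is the source map. -/
def free (G : OGraph.{u}) (φ : WalkingParallelPair.zero ⟶ WalkingParallelPair.one) : Set G.Point :=
  {p | TypedGraph.IsEdgePoint G.typed p ∧ ∀ e : G.Edge, G.typed.left.map φ e ≠ p}

/-- Openness in terms of the end maps. -/
theorem edge_eq_of_end_eq {G : OGraph.{u}}
    (φ : WalkingParallelPair.zero ⟶ WalkingParallelPair.one) {p : G.Point}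
    (hp : TypedGraph.IsEdgePoint G.typed p) {e e' : G.Edge} (h : G.typed.left.map φ e = p)
    (h' : G.typed.left.map φ e' = p) : e = e' := by
  rcases φ with _ | _
  · exact (G.isOpen p hp e e').2 h h'
  · exact (G.isOpen p hp e e').1 h h'

end OGraph

namespace OHom

variable {G H K X : OGraph.{u}}

/-- The action of an open-graph morphism on points and on edges. -/
abbrev app (f : OHom G H) (Z : WalkingParallelPair) (x : G.typed.left.obj Z) :
    H.typed.left.obj Z :=
  f.hom.left.app Z x

/-- A morphism is injective if it is so on points and on edges. -/
def Inj (f : OHom G H) : Prop := ∀ Z, Function.Injective (f.app Z)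

theorem app_map (f : OHom G H) {Z W : WalkingParallelPair} (φ : Z ⟶ W)
    (x : G.typed.left.obj Z) :
    f.app W (G.typed.left.map φ x) = H.typed.left.map φ (f.app Z x) :=
  NatTrans.naturality_apply f.hom.left φ x

theorem type_app (f : OHom G H) (p : G.Point) :
    TypedGraph.type H.typed (f.onPoint p) = TypedGraph.type G.typed p := by
  have h := congrArg (fun t => t.app WalkingParallelPair.one p) (Over.w f.hom)
  exact h

theorem isEdgePoint_iff (f : OHom G H) (p : G.Point) :
    TypedGraph.IsEdgePoint H.typed (f.onPoint p) ↔ TypedGraph.IsEdgePoint G.typed p := by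
  unfold TypedGraph.IsEdgePoint
  rw [f.type_app]

theorem isVertex_iff (f : OHom G H) (p : G.Point) :
    TypedGraph.IsVertex H.typed (f.onPoint p) ↔ TypedGraph.IsVertex G.typed p := by
  unfold TypedGraph.IsVertex
  rw [f.type_app]

theorem hom_ext {f g : OHom G H} (h : ∀ Z x, f.app Z x = g.app Z x) : f = g := by
  apply OHom.ext
  apply Over.OverMorphism.ext
  ext Z x
  exact h Z x

theorem app_eq {f : G.typed ⟶ H.typed} {g : G.typed ⟶ H.typed} (h : f = g)
    (Z : WalkingParallelPair) (x : G.typed.left.obj Z) : f.left.app Z x = g.left.app Z x := by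
  rw [h]

theorem hom_eq_of_app {f g : G.typed ⟶ H.typed} (h : ∀ Z x, f.left.app Z x = g.left.app Z x) :
    f = g := by
  apply Over.OverMorphism.ext
  ext Z x
  exact h Z x

theorem Inj.isMono {f : OHom G H} (hf : f.Inj) : f.IsMono := by
  intro X g h e
  exact hom_ext fun Z x => hf Z (app_eq e Z x)

/-- Quantifying over the end map `φ` lets sources and targets, hence outputs and inputs, be treated
by one argument. -/
theorem full_iff (f : G.typed ⟶ H.typed) :
    TypedGraph.FullOnVertices f ↔
      ∀ v : G.Point, TypedGraph.IsVertex G.typed v → ∀ e : H.Edge,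
        ∀ φ : WalkingParallelPair.zero ⟶ WalkingParallelPair.one,
          H.typed.left.map φ e = f.left.app _ v → ∃ e', f.left.app _ e' = e := by
  constructor
  · rintro h v hv e (_ | _) he
    · exact h v hv e (Or.inl he)
    · exact h v hv e (Or.inr he)
  · rintro h v hv e (he | he)
    · exact h v hv e WalkingParallelPairHom.left he
    · exact h v hv e WalkingParallelPairHom.right he

theorem exists_edge (f : OHom G H) {v : G.Point} (hv : TypedGraph.IsVertex G.typed v) {e : H.Edge}
    {φ : WalkingParallelPair.zero ⟶ WalkingParallelPair.one}
    (he : H.typed.left.map φ e = f.app _ v) : ∃ e', f.app _ e' = e :=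
  (full_iff f.hom).1 f.full v hv e φ he

/-- The composite of open-graph morphisms, the second of which is injective. -/
def comp (f : OHom G H) (g : OHom H K) (hg : g.Inj) : OHom G K where
  hom := f.hom ≫ g.hom
  full := by
    rw [full_iff]
    intro v hv e φ he
    obtain ⟨e', rfl⟩ := g.exists_edge ((f.isVertex_iff v).2 hv) he
    -- Injectivity of `g` makes `e'` adjacent to the image of `v` itself rather than to another
    -- point identified with it; without it fullness can fail for composites.
    obtain ⟨e'', rfl⟩ := f.exists_edge (e := e') (φ := φ) hv (hg _ ((g.app_map φ e').trans he))
    exact ⟨e'', rfl⟩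

theorem comp_app (f : OHom G H) (g : OHom H K) (hg : g.Inj) (Z : WalkingParallelPair)
    (x : G.typed.left.obj Z) : (f.comp g hg).app Z x = g.app Z (f.app Z x) := rfl

theorem Inj.comp {f : OHom G H} (hf : f.Inj) {g : OHom H K} (hg : g.Inj) : (f.comp g hg).Inj :=
  fun Z _ _ h => hf Z (hg Z h)

theorem Inj.of_comp {f : OHom G H} {g : OHom H K} {h : OHom G K} (hh : h.Inj)
    (e : ∀ Z x, g.app Z (f.app Z x) = h.app Z x) : f.Inj :=
  fun Z x y hxy => hh Z (by rw [← e, ← e, hxy])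

/-- A morphism whose image lies in the image of an injective morphism factors through it. -/
theorem exists_lift (f : OHom X H) (i : OHom G H) (hi : i.Inj)
    (h : ∀ Z x, f.app Z x ∈ Set.range (i.app Z)) :
    ∃ g : OHom X G, ∀ Z x, i.app Z (g.app Z x) = f.app Z x := by
  choose a ha using h
  let t : X.typed.left ⟶ G.typed.left :=
    { app := fun Z => TypeCat.ofHom (a Z)
      naturality := by
        intro Z W φ
        ext x
        apply hi W
        have h₁ := ha W (X.typed.left.map φ x)
        have h₂ := i.app_map φ (a Z x)
        have h₃ := f.app_map φ x
        rw [ha Z x] at h₂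
        exact h₁.trans (h₃.trans h₂.symm) }
  have ht : t ≫ i.hom.left = f.hom.left := by
    ext Z x
    exact ha Z x
  let g : X.typed ⟶ G.typed := Over.homMk t (by rw [← Over.w i.hom, ← Category.assoc, ht, Over.w])
  have hg : ∀ Z x, i.app Z (g.left.app Z x) = f.app Z x := ha
  refine ⟨⟨g, (full_iff g).2 fun v hv e φ he => ?_⟩, hg⟩
  have h₁ : H.typed.left.map φ (i.app _ e) = f.app _ v := by
    rw [← hg, ← i.app_map φ e, he]
  obtain ⟨e', he'⟩ := f.exists_edge hv h₁
  exact ⟨e', hi _ ((hg _ e').trans he')⟩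

theorem mem_free_of_app_mem (f : OHom G H)
    {φ : WalkingParallelPair.zero ⟶ WalkingParallelPair.one} {p : G.Point}
    (h : f.app _ p ∈ H.free φ) : p ∈ G.free φ :=
  ⟨(f.isEdgePoint_iff p).1 h.1, fun e he => h.2 (f.app _ e) (by rw [← f.app_map, he])⟩

end OHom

/-! ### Subgraphs -/

namespace OGraph

/-- The open-graph carried by a subfunctor. -/
def sub (H : OGraph.{u}) (S : Subfunctor H.typed.left) : OGraph.{u} where
  typed := Over.mk (S.ι ≫ H.typed.hom)
  isOpen := by
    intro p hp e e'
    constructor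
    · intro h₁ h₂
      exact Subtype.ext (((H.isOpen p.1 hp e.1 e'.1).1) (congrArg Subtype.val h₁)
        (congrArg Subtype.val h₂))
    · intro h₁ h₂
      exact Subtype.ext (((H.isOpen p.1 hp e.1 e'.1).2) (congrArg Subtype.val h₁)
        (congrArg Subtype.val h₂))

/-- The inclusion of a subgraph that contains every edge adjacent to one of its vertices. -/
def incl (H : OGraph.{u}) (S : Subfunctor H.typed.left)
    (hS : ∀ v ∈ S.obj WalkingParallelPair.one, TypedGraph.IsVertex H.typed v →
      ∀ (e : H.Edge) (φ : WalkingParallelPair.zero ⟶ WalkingParallelPair.one),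
        H.typed.left.map φ e = v → e ∈ S.obj WalkingParallelPair.zero) :
    OHom (H.sub S) H where
  hom := Over.homMk S.ι rfl
  full := (OHom.full_iff (G := H.sub S) _).2 fun v hv e φ he => ⟨⟨e, hS v.1 v.2 hv e φ he⟩, rfl⟩

theorem exists_subgraph (H : OGraph.{u}) (S : Subfunctor H.typed.left)
    (hS : ∀ v ∈ S.obj WalkingParallelPair.one, TypedGraph.IsVertex H.typed v →
      ∀ (e : H.Edge) (φ : WalkingParallelPair.zero ⟶ WalkingParallelPair.one),
        H.typed.left.map φ e = v → e ∈ S.obj WalkingParallelPair.zero) :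
    ∃ (K : OGraph.{u}) (i : OHom K H), i.Inj ∧ ∀ Z, Set.range (i.app Z) = S.obj Z :=
  ⟨H.sub S, H.incl S hS, fun _ _ _ h => Subtype.ext h, fun _ => Subtype.range_coe⟩

/-- The graph with edge-points `P` and no edges. -/
def points (P : Type u) : OGraph.{u} where
  typed := Over.mk (X := typeGraph.{u}) (Y := parallelPair (X := PEmpty.{u+1}) (Y := P)
      (TypeCat.ofHom PEmpty.elim) (TypeCat.ofHom PEmpty.elim))
    { app := fun Z => match Z with
        | .zero => TypeCat.ofHom (PEmpty.elim)
        | .one => TypeCat.ofHom (fun _ => TypePoint.eps)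
      naturality := by
        rintro _ _ (_ | _ | _)
        · ext x; exact x.elim
        · ext x; exact x.elim
        · simp }
  isOpen := fun _ _ e => PEmpty.elim e

theorem points_isPointGraph (P : Type u) : (points P).IsPointGraph :=
  fun _ => ⟨⟨rfl, fun e => PEmpty.elim e⟩, ⟨rfl, fun e => PEmpty.elim e⟩⟩

/-- A family of edge-points, as a morphism. -/
def pointsHom {P : Type u} (G : OGraph.{u}) (f : P → G.Point)
    (hf : ∀ x, TypedGraph.IsEdgePoint G.typed (f x)) : OHom (points P) G where
  hom := Over.homMk
    { app := fun Z => match Z with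
        | .zero => TypeCat.ofHom (PEmpty.elim)
        | .one => TypeCat.ofHom f
      naturality := by
        rintro _ _ (_ | _ | _)
        · ext x; exact x.elim
        · ext x; exact x.elim
        · simp }
    (by
      ext Z x
      rcases Z with _ | _
      · exact PEmpty.elim x
      · exact hf x)
  full := fun _ hv => by cases hv

end OGraph

/-! ### Monomorphisms and injectivity -/

/-- The graph with a single edge-point is a test object: maps out of it pick edge-points, and
fullness is vacuous for them. -/
theorem OHom.IsMono.eq_of_edgePoint {G H : OGraph.{u}} {f : OHom G H} (hf : f.IsMono)
    {p q : G.Point} (hp : TypedGraph.IsEdgePoint G.typed p) (hq : TypedGraph.IsEdgePoint G.typed q)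
    (h : f.onPoint p = f.onPoint q) : p = q := by
  have := hf _ (G.pointsHom (P := PUnit) (fun _ => p) (fun _ => hp))
    (G.pointsHom (fun _ => q) (fun _ => hq)) (OHom.hom_eq_of_app (G := OGraph.points PUnit) (by
      rintro (_ | _) x
      · exact PEmpty.elim x
      · exact h))
  exact congrArg (fun t : OHom (OGraph.points PUnit) G => t.onPoint PUnit.unit) this

theorem OGraph.IsPointGraph.isEmpty_edge {B : OGraph.{u}} (hB : B.IsPointGraph) :
    IsEmpty B.Edge :=
  ⟨fun e => (hB (B.typed.left.map WalkingParallelPairHom.right e)).1.2 e rfl⟩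

theorem OHom.IsMono.inj_of_isPointGraph {B G : OGraph.{u}} {f : OHom B G} (hf : f.IsMono)
    (hB : B.IsPointGraph) : f.Inj := by
  rintro (_ | _) x y h
  · exact (hB.isEmpty_edge.false x).elim
  · exact hf.eq_of_edgePoint (hB x).1.1 (hB y).1.1 h

/-! ### Adhesive pushouts, elementwise -/

/-- A commutative square that presents its fourth corner as the union of two subgraphs, with the
first corner as their intersection. -/
structure IsUnion {A B C D : OGraph.{u}} (f : OHom A B) (g : OHom A C)
    (i : OHom B D) (j : OHom C D) : Prop where
  comm : ∀ Z x, i.app Z (f.app Z x) = j.app Z (g.app Z x)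
  inj_left : i.Inj
  inj_right : j.Inj
  cover : ∀ Z y, (∃ x, i.app Z x = y) ∨ ∃ x, j.app Z x = y
  inter : ∀ Z x y, i.app Z x = j.app Z y → ∃ a, f.app Z a = x ∧ g.app Z a = y

/-- Pushouts of typed graphs are computed in sets, separately on points and on edges, and a union of
subsets is the pushout over the intersection. The induced map is full because each vertex of `D`
comes from `B` or `C`, where `p` or `q` is full. -/
theorem IsUnion.isAdhesivePushout {A B C D : OGraph.{u}} {f : OHom A B} {g : OHom A C}
    {i : OHom B D} {j : OHom C D} (h : IsUnion f g i j) (hf : f.Inj) :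
    IsAdhesivePushout f g i j := by
  have hs : IsPushout f.hom g.hom i.hom j.hom := by
    apply IsPushout.of_map (Over.forget typeGraph) (OHom.hom_eq_of_app (fun Z x => h.comm Z x))
    apply IsPushout.of_forall_isPushout_app
    intro Z
    have : Mono (((Over.forget typeGraph).map i.hom).app Z) :=
      (mono_iff_injective _).2 (h.inj_left Z)
    apply Types.isPushout_of_isPullback_of_mono'
    · rw [Types.isPullback_iff]
      refine ⟨?_, fun x y hxy => hf Z hxy.1, h.inter Z⟩
      ext x
      exact h.comm Z x
    · exact Set.eq_univ_of_forall fun y => h.cover Z y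
    · intro x y _ _ hxy
      exact h.inj_right Z hxy
  refine ⟨fun X p q hpq => ?_, hs⟩
  have h₁ : ∀ Z x, (hs.desc p.hom q.hom hpq).left.app Z (i.app Z x) = p.app Z x :=
    fun Z x => OHom.app_eq (hs.inl_desc p.hom q.hom hpq) Z x
  have h₂ : ∀ Z x, (hs.desc p.hom q.hom hpq).left.app Z (j.app Z x) = q.app Z x :=
    fun Z x => OHom.app_eq (hs.inr_desc p.hom q.hom hpq) Z x
  refine ⟨⟨hs.desc p.hom q.hom hpq, (OHom.full_iff _).2 fun v hv e φ he => ?_⟩,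
    ⟨hs.inl_desc _ _ _, hs.inr_desc _ _ _⟩, fun w hw => OHom.ext (hs.hom_ext ?_ ?_)⟩
  · rcases h.cover _ v with ⟨x, rfl⟩ | ⟨x, rfl⟩
    · obtain ⟨e', rfl⟩ := p.exists_edge ((i.isVertex_iff x).1 hv) (he.trans (h₁ _ x))
      exact ⟨_, h₁ _ e'⟩
    · obtain ⟨e', rfl⟩ := q.exists_edge ((j.isVertex_iff x).1 hv) (he.trans (h₂ _ x))
      exact ⟨_, h₂ _ e'⟩
  · rw [hw.1, hs.inl_desc]
  · rw [hw.2, hs.inr_desc]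

/-- A pushout of injections of sets consists of injections and is also a pullback. -/
theorem IsAdhesivePushout.isUnion {A B C D : OGraph.{u}} {f : OHom A B} {g : OHom A C}
    {i : OHom B D} {j : OHom C D} (h : IsAdhesivePushout f g i j) (hf : f.Inj) (hg : g.Inj) :
    IsUnion f g i j := by
  have hZ : ∀ Z, IsPushout (f.hom.left.app Z) (g.hom.left.app Z) (i.hom.left.app Z)
      (j.hom.left.app Z) := fun Z => (h.slice.map (Over.forget typeGraph)).app Z
  refine ⟨fun Z x => OHom.app_eq h.slice.w Z x, fun Z => ?_, fun Z => ?_, fun Z y => ?_,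
    fun Z => ?_⟩
  · exact Types.pushoutCocone_inr_injective_of_isColimit (hZ Z).flip.isColimit (hg Z)
  · exact Types.pushoutCocone_inr_injective_of_isColimit (hZ Z).isColimit (hf Z)
  · exact Types.eq_or_eq_of_isPushout (hZ Z) y
  · exact ((Types.isPullback_iff _ _ _ _).1 (Types.isPullback_of_isPushout (hZ Z) (hf Z))).2.2

/-- The context of a rule at a mono matching contains the boundary. -/
theorem IsAdhesivePushout.inj_of_isMono {A B C D : OGraph.{u}} {f : OHom A B} {g : OHom A C}
    {i : OHom B D} {j : OHom C D} (h : IsAdhesivePushout f g i j) (hA : A.IsPointGraph)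
    (hf : f.Inj) (hi : i.IsMono) : g.Inj := by
  rintro (_ | _) x y hxy
  · exact (hA.isEmpty_edge.false x).elim
  · refine hf _ (hi.eq_of_edgePoint ((f.isEdgePoint_iff x).2 (hA x).1.1)
      ((f.isEdgePoint_iff y).2 (hA y).1.1) ?_)
    have h₁ := OHom.app_eq h.slice.w WalkingParallelPair.one x
    have h₂ := OHom.app_eq h.slice.w WalkingParallelPair.one y
    exact h₁.trans ((congrArg (j.app _) hxy).trans h₂.symm)

/-! ### The canonical boundary -/

namespace OGraph

/-- The point-graph `In(G) + Out(G)`. -/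
def bd (G : OGraph.{u}) : OGraph.{u} := points (G.inputs ⊕ G.outputs)

/-- The canonical map of the boundary into the graph. -/
def bdMap (G : OGraph.{u}) : OHom G.bd G :=
  G.pointsHom (Sum.elim Subtype.val Subtype.val) (by
    rintro (x | x)
    · exact x.2.1
    · exact x.2.1)

/-- The summand `In(G)` of the boundary. -/
def bdIns (G : OGraph.{u}) : Set G.bd.Point :=
  Set.range (Sum.inl : G.inputs → G.inputs ⊕ G.outputs)

theorem isBoundaryMap_bdMap (G : OGraph.{u}) : IsBoundaryMap G.bdMap G.bdIns where
  pointGraph := points_isPointGraph _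
  bij_inputs := by
    refine ⟨?_, ?_, ?_⟩
    · rintro _ ⟨x, rfl⟩
      exact x.2
    · rintro _ ⟨x, rfl⟩ _ ⟨y, rfl⟩ h
      exact congrArg Sum.inl (Subtype.ext h)
    · intro x hx
      exact ⟨Sum.inl ⟨x, hx⟩, ⟨_, rfl⟩, rfl⟩
  bij_outputs := by
    refine ⟨?_, ?_, ?_⟩
    · rintro (x | x) hx
      · exact (hx ⟨x, rfl⟩).elim
      · exact x.2
    · rintro (x | x) hx (y | y) hy h
      · exact (hx ⟨x, rfl⟩).elim
      · exact (hx ⟨x, rfl⟩).elim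
      · exact (hy ⟨y, rfl⟩).elim
      · exact congrArg Sum.inr (Subtype.ext h)
    · intro x hx
      refine ⟨Sum.inr ⟨x, hx⟩, ?_, rfl⟩
      rintro ⟨_, h⟩
      cases h

end OGraph

theorem IsBoundaryMap.mem_inputs_or_mem_outputs {B G : OGraph.{u}} {b : OHom B G}
    {ins : Set B.Point} (h : IsBoundaryMap b ins) (x : B.Point) :
    b.app _ x ∈ G.inputs ∨ b.app _ x ∈ G.outputs := by
  by_cases hx : x ∈ ins
  · exact Or.inl (h.bij_inputs.mapsTo hx)
  · exact Or.inr (h.bij_outputs.mapsTo hx)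

/-- The map is injective on each summand, so only an isolated edge-point, hit once from each, can
break injectivity. The right-hand side depends on `G` alone, which allows boundary maps of the same
graph to be compared. -/
theorem IsBoundaryMap.inj_iff {B G : OGraph.{u}} {b : OHom B G} {ins : Set B.Point}
    (h : IsBoundaryMap b ins) : b.Inj ↔ Disjoint G.inputs G.outputs := by
  rw [Set.disjoint_left]
  constructor
  · intro hb p hi ho
    obtain ⟨x, hx, rfl⟩ := h.bij_inputs.surjOn hi
    obtain ⟨y, hy, hxy⟩ := h.bij_outputs.surjOn ho
    exact hy (hb _ hxy ▸ hx)
  · rintro hd (_ | _) x y hxy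
    · exact (h.pointGraph.isEmpty_edge.false x).elim
    · by_cases hx : x ∈ ins <;> by_cases hy : y ∈ ins
      · exact h.bij_inputs.injOn hx hy hxy
      · exact (hd (h.bij_inputs.mapsTo hx)
          ((congrArg (· ∈ G.outputs) hxy).mpr (h.bij_outputs.mapsTo hy))).elim
      · exact (hd (h.bij_inputs.mapsTo hy)
          ((congrArg (· ∈ G.outputs) hxy).mp (h.bij_outputs.mapsTo hx))).elim
      · exact h.bij_outputs.injOn hx hy hxy

/-! ### Extensions -/

section Extension

variable {L B G D : OGraph.{u}} {b : OHom B L} {c : OHom B D} {m : OHom L G} {s : OHom D G}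
  {φ : WalkingParallelPair.zero ⟶ WalkingParallelPair.one} {I : Set B.Point}

/-- Which boundary points of the context stay boundary points of the union depends on the context
and on the splitting of the boundary only. -/
theorem IsUnion.mem_free_iff (h : IsUnion b c m s) (hb : b.Inj)
    (hI : Set.BijOn b.onPoint I (L.free φ)) (p : D.Point) :
    s.app _ p ∈ G.free φ ↔ p ∈ D.free φ ∧ ∀ x, c.app _ x = p → x ∈ I := by
  constructor
  · intro hp
    refine ⟨s.mem_free_of_app_mem hp, ?_⟩
    rintro x rfl
    rw [← h.comm] at hp
    obtain ⟨y, hy, hyx⟩ := hI.surjOn (m.mem_free_of_app_mem hp)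
    exact hb _ hyx ▸ hy
  · rintro ⟨hp, hc⟩
    refine ⟨(s.isEdgePoint_iff p).2 hp.1, fun e he => ?_⟩
    rcases h.cover _ e with ⟨e', rfl⟩ | ⟨e', rfl⟩
    · rw [← m.app_map] at he
      obtain ⟨x, hx, hxp⟩ := h.inter _ _ _ he
      -- An edge of `L` can end at `p` only if `p` is glued to a boundary point of `L`, which the
      -- condition on `I` makes free in `L`.
      exact (hI.mapsTo (hc x hxp)).2 e' hx.symm
    · rw [← s.app_map] at he
      exact hp.2 e' (h.inj_right _ he)

theorem IsUnion.free_subset_range (h : IsUnion b c m s)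
    (hI : Set.BijOn b.onPoint I (L.free φ)) {p : G.Point} (hp : p ∈ G.free φ) :
    ∃ d, s.app _ d = p := by
  rcases h.cover _ p with ⟨l, rfl⟩ | hd
  · obtain ⟨x, -, rfl⟩ := hI.surjOn (m.mem_free_of_app_mem hp)
    exact ⟨c.app _ x, (h.comm _ x).symm⟩
  · exact hd

/-- All free points of `G` and `G'` come from `D`, and `IsUnion.mem_free_iff` decides freeness in
either graph by the same condition on `D` and `I`. -/
theorem IsUnion.bijOn_free {R G' B' : OGraph.{u}} {b' : OHom B R} {n : OHom R G'} {s' : OHom D G'}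
    {k : OHom B' D} {t : OHom B' G} {t' : OHom B' G'} {J : Set B'.Point}
    (h : IsUnion b c m s) (h' : IsUnion b' c n s') (hb : b.Inj) (hb' : b'.Inj)
    (hI : Set.BijOn b.onPoint I (L.free φ)) (hI' : Set.BijOn b'.onPoint I (R.free φ))
    (hk : ∀ x, s.app _ (k.app .one x) = t.app _ x)
    (hk' : ∀ x, s'.app _ (k.app .one x) = t'.app _ x)
    (hJ : Set.BijOn t.onPoint J (G.free φ)) : Set.BijOn t'.onPoint J (G'.free φ) := by
  have key : ∀ p, s.app _ p ∈ G.free φ ↔ s'.app _ p ∈ G'.free φ := fun p => by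
    rw [h.mem_free_iff hb hI, h'.mem_free_iff hb' hI']
  refine ⟨fun x hx => ?_, fun x hx y hy hxy => ?_, fun p hp => ?_⟩
  · have := hJ.mapsTo hx
    change t'.app _ x ∈ _
    rw [← hk', ← key, hk]
    exact this
  · have h₁ : k.app _ x = k.app _ y := h'.inj_right _ ((hk' x).trans (hxy.trans (hk' y).symm))
    exact hJ.injOn hx hy ((hk x).symm.trans ((congrArg _ h₁).trans (hk y)))
  · obtain ⟨d, rfl⟩ := h'.free_subset_range hI' hp
    obtain ⟨x, hx, hxd⟩ := hJ.surjOn ((key d).2 hp)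
    have h₁ : k.app _ x = d := h.inj_right _ ((hk x).trans hxd)
    exact ⟨x, hx, (hk' x).symm.trans (congrArg _ h₁)⟩

end Extension

/-- A double pushout has an extension, whose left leg is the canonical boundary map. -/
theorem exists_extension {L B R G D G' : OGraph.{u}} (r : RewriteRule L B R) {c : OHom B D}
    {m : OHom L G} {s : OHom D G} {n : OHom R G'} {s' : OHom D G'}
    (h : IsUnion r.left c m s) (h' : IsUnion r.right c n s') :
    ∃ (e : BoundarySpan G G.bd G') (k : OHom G.bd D), e.left = G.bdMap ∧ e.ins = G.bdIns ∧
      IsExtension r m e ∧ (e.left.Inj → e.right.Inj) ∧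
      (∀ Z x, s.app Z (k.app Z x) = e.left.app Z x) ∧
      (∀ Z x, s'.app Z (k.app Z x) = e.right.app Z x) := by
  have hb := r.isRule.1.inj_of_isPointGraph r.isBoundary_left.pointGraph
  have hb' := r.isRule.2.inj_of_isPointGraph r.isBoundary_right.pointGraph
  obtain ⟨k, hk⟩ := G.bdMap.exists_lift s h.inj_right (by
    rintro (_ | _) x
    · exact (G.isBoundaryMap_bdMap.pointGraph.isEmpty_edge.false x).elim
    · rcases G.isBoundaryMap_bdMap.mem_inputs_or_mem_outputs x with hx | hx
      · exact h.free_subset_range r.isBoundary_left.bij_inputs hx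
      · exact h.free_subset_range r.isBoundary_left.bij_outputs hx)
  have hk' : ∀ Z x, s'.app Z (k.app Z x) = (k.comp s' h'.inj_right).app Z x := fun _ _ => rfl
  refine ⟨⟨G.bdMap, k.comp s' h'.inj_right, G.bdIns, G.isBoundaryMap_bdMap,
    ⟨G.isBoundaryMap_bdMap.pointGraph, ?_, ?_⟩⟩, k, rfl, rfl, ⟨h.inj_left.isMono, D, c, s, n, s',
      h.isAdhesivePushout hb, h'.isAdhesivePushout hb', k, OHom.hom_eq_of_app hk, rfl⟩, ?_, hk, hk'⟩
  · exact h.bijOn_free h' hb hb' r.isBoundary_left.bij_inputs r.isBoundary_right.bij_inputs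
      (hk _) (hk' _) G.isBoundaryMap_bdMap.bij_inputs
  · exact h.bijOn_free h' hb hb' r.isBoundary_left.bij_outputs r.isBoundary_right.bij_outputs
      (hk _) (hk' _) G.isBoundaryMap_bdMap.bij_outputs
  -- Injectivity of the left leg passes to `k`, hence to the right leg.
  · intro hi
    exact (OHom.Inj.of_comp hi hk).comp h'.inj_right

/-- A double pushout at a mono matching is a pair of unions. -/
theorem IsExtension.exists_isUnion {L B R G B' G' : OGraph.{u}} {r : RewriteRule L B R}
    {m : OHom L G} {e : BoundarySpan G B' G'} (h : IsExtension r m e) :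
    ∃ (D : OGraph.{u}) (c : OHom B D) (s : OHom D G) (n : OHom R G') (s' : OHom D G'),
      IsUnion r.left c m s ∧ IsUnion r.right c n s' := by
  obtain ⟨hm, D, c, s, n, s', h₁, h₂, -⟩ := h
  have hB := r.isBoundary_left.pointGraph
  have hb := r.isRule.1.inj_of_isPointGraph hB
  have hb' := r.isRule.2.inj_of_isPointGraph hB
  have hc := h₁.inj_of_isMono hB hb hm
  exact ⟨D, c, s, n, s', h₁.isUnion hb hc, h₂.isUnion hb' hc⟩

/-! ### Complements, intersections and unions of subgraphs -/

theorem OGraph.exists_bdMap_eq {G : OGraph.{u}}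
    {φ : WalkingParallelPair.zero ⟶ WalkingParallelPair.one} {p : G.Point} (hp : p ∈ G.free φ) :
    ∃ x, G.bdMap.app _ x = p := by
  rcases φ with _ | _
  · exact ⟨Sum.inr ⟨p, hp⟩, rfl⟩
  · exact ⟨Sum.inl ⟨p, hp⟩, rfl⟩

theorem TypedGraph.isVertex_or_isEdgePoint (G : TypedGraph.{u}) (p : Point G) :
    IsVertex G p ∨ IsEdgePoint G p := by
  unfold IsVertex IsEdgePoint
  cases type G p
  · exact Or.inl rfl
  · exact Or.inr rfl

theorem OGraph.isEmpty_bd_edge (G : OGraph.{u}) : IsEmpty G.bd.Edge :=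
  G.isBoundaryMap_bdMap.pointGraph.isEmpty_edge

/-- The part of `G` outside a subgraph `M`, together with the boundary of `M`. -/
theorem OHom.exists_complement {M G : OGraph.{u}} (j : OHom M G) :
    ∃ (D : OGraph.{u}) (d : OHom D G), d.Inj ∧ ∀ Z y, y ∈ Set.range (d.app Z) ↔
      (y ∉ Set.range (j.app Z) ∨ ∃ x, j.app Z (M.bdMap.app Z x) = y) := by
  -- An edge outside `M` meets `M` only in its boundary: at a vertex fullness would put the edge in
  -- `M`, and at an edge-point already carrying a `φ`-edge of `M` openness would.
  have key : ∀ (φ : WalkingParallelPair.zero ⟶ WalkingParallelPair.one) (e : G.Edge),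
      e ∉ Set.range (j.app _) → G.typed.left.map φ e ∉ Set.range (j.app _) ∨
        ∃ x, j.app _ (M.bdMap.app _ x) = G.typed.left.map φ e := by
    intro φ e he
    by_cases hp : G.typed.left.map φ e ∈ Set.range (j.app _)
    · obtain ⟨p, hp⟩ := hp
      rcases TypedGraph.isVertex_or_isEdgePoint M.typed p with hv | hv
      · exact (he (j.exists_edge hv hp.symm)).elim
      · obtain ⟨x, hx⟩ := OGraph.exists_bdMap_eq (G := M) (φ := φ) (p := p) ⟨hv, fun e' he' =>
          he ⟨e', OGraph.edge_eq_of_end_eq φ ((j.isEdgePoint_iff p).2 hv)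
            (by rw [← j.app_map, he']) hp.symm⟩⟩
        exact Or.inr ⟨x, by rw [hx, hp]⟩
    · exact Or.inl hp
  let S : Subfunctor G.typed.left :=
    { obj := fun Z => {y | y ∉ Set.range (j.app Z) ∨ ∃ x, j.app Z (M.bdMap.app Z x) = y}
      map := by
        rintro _ _ (_ | _ | _) y hy
        · rcases hy with hy | ⟨x, -⟩
          · exact key _ y hy
          · exact (M.isEmpty_bd_edge.false x).elim
        · rcases hy with hy | ⟨x, -⟩
          · exact key _ y hy
          · exact (M.isEmpty_bd_edge.false x).elim
        · simpa using hy }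
  obtain ⟨D, d, hd, hr⟩ := G.exists_subgraph S (by
    rintro v (hv | ⟨x, rfl⟩) hvv e φ he
    · subst he
      refine Or.inl ?_
      rintro ⟨e', rfl⟩
      exact hv ⟨_, j.app_map φ e'⟩
    · have h₁ : TypedGraph.IsEdgePoint G.typed (j.app _ (M.bdMap.app _ x)) :=
        (j.isEdgePoint_iff _).2 ((M.bdMap.isEdgePoint_iff x).2
          (M.isBoundaryMap_bdMap.pointGraph x).1.1)
      exact absurd (hvv.symm.trans h₁) (by simp))
  exact ⟨D, d, hd, fun Z y => by rw [hr]; rfl⟩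

theorem OHom.exists_union {A B G : OGraph.{u}} (f : OHom A G) (g : OHom B G) :
    ∃ (M : OGraph.{u}) (j : OHom M G), j.Inj ∧
      ∀ Z y, y ∈ Set.range (j.app Z) ↔ y ∈ Set.range (f.app Z) ∨ y ∈ Set.range (g.app Z) := by
  obtain ⟨M, j, hj, hr⟩ := G.exists_subgraph
    (Subfunctor.range f.hom.left ⊔ Subfunctor.range g.hom.left) (by
      rintro _ (⟨x, rfl⟩ | ⟨x, rfl⟩) hv e φ he
      · exact Or.inl (f.exists_edge ((f.isVertex_iff x).1 hv) he)
      · exact Or.inr (g.exists_edge ((g.isVertex_iff x).1 hv) he))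
  exact ⟨M, j, hj, fun Z y => by rw [hr]; rfl⟩

/-- The preimage of a subgraph. -/
theorem OHom.exists_preimage {A M G : OGraph.{u}} (f : OHom A G) (j : OHom M G) :
    ∃ (D : OGraph.{u}) (a : OHom D A), a.Inj ∧
      ∀ Z y, y ∈ Set.range (a.app Z) ↔ f.app Z y ∈ Set.range (j.app Z) := by
  obtain ⟨D, a, ha, hr⟩ := A.exists_subgraph
    ((Subfunctor.range j.hom.left).preimage f.hom.left) (by
      rintro v ⟨x, hx⟩ hv e φ rfl
      have h₁ : TypedGraph.IsVertex G.typed (j.onPoint x) :=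
        (congrArg (TypedGraph.type G.typed) hx).trans ((f.isVertex_iff _).2 hv)
      exact j.exists_edge ((j.isVertex_iff x).1 h₁) ((f.app_map φ e).symm.trans hx.symm))
  exact ⟨D, a, ha, fun Z y => by rw [hr]; rfl⟩

/-! ### Restriction of a rewrite to a subgraph containing the matching -/

/-- If `r` rewrites `G` to `G'` and the subgraph `M` of `G` contains the matching, then `r` rewrites
`M` to a subgraph `H` of `G'`, and `G'` is the union of `H` and the complement `D₀` of `M`. -/
theorem exists_restriction {L B R G D G' M D₀ : OGraph.{u}} (r : RewriteRule L B R) {c : OHom B D}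
    {m : OHom L G} {s : OHom D G} {n : OHom R G'} {s' : OHom D G'}
    (h : IsUnion r.left c m s) (h' : IsUnion r.right c n s')
    {j : OHom M G} (hj : j.Inj) {i : OHom L M} (hi : ∀ Z x, j.app Z (i.app Z x) = m.app Z x)
    (hM : M.bdMap.Inj) {d : OHom D₀ G} (hd : d.Inj)
    (hdr : ∀ Z y, y ∈ Set.range (d.app Z) ↔
      (y ∉ Set.range (j.app Z) ∨ ∃ x, j.app Z (M.bdMap.app Z x) = y))
    {c₀ : OHom M.bd D₀} (hc₀ : ∀ Z x, d.app Z (c₀.app Z x) = j.app Z (M.bdMap.app Z x)) :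
    ∃ (H : OGraph.{u}) (e : BoundarySpan M M.bd H) (g : OHom H G') (t : OHom D₀ G'),
      e.left = M.bdMap ∧ e.ins = M.bdIns ∧ IsExtension r i e ∧ e.right.Inj ∧
      IsUnion e.right c₀ g t := by
  -- The restricted context is `D' = D ∩ M`; the result `H` is the union of `R` and `D'` in `G'`.
  obtain ⟨D', a, ha, har⟩ := s.exists_preimage j
  obtain ⟨sM, hsM⟩ := (a.comp s h.inj_right).exists_lift j hj
    (fun Z x => (har Z _).1 ⟨x, rfl⟩)
  simp only [OHom.comp_app] at hsM
  obtain ⟨c', hc'⟩ := c.exists_lift a ha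
    (fun Z x => (har Z _).2 ⟨i.app Z (r.left.app Z x), by rw [hi, h.comm]⟩)
  obtain ⟨H, g, hg, hgr⟩ := n.exists_union (a.comp s' h'.inj_right)
  obtain ⟨nH, hnH⟩ := n.exists_lift g hg (fun Z x => (hgr Z _).2 (Or.inl ⟨x, rfl⟩))
  obtain ⟨sH, hsH⟩ := (a.comp s' h'.inj_right).exists_lift g hg
    (fun Z x => (hgr Z _).2 (Or.inr ⟨x, rfl⟩))
  simp only [OHom.comp_app] at hsH
  have hMu : IsUnion r.left c' i sM :=
    { comm := fun Z x => hj Z (by rw [hi, hsM, hc', h.comm])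
      inj_left := OHom.Inj.of_comp h.inj_left hi
      inj_right := fun Z x y hxy => ha Z (h.inj_right Z (by rw [← hsM, ← hsM, hxy]))
      cover := fun Z y => by
        rcases h.cover Z (j.app Z y) with ⟨x, hx⟩ | ⟨x, hx⟩
        · exact Or.inl ⟨x, hj Z (by rw [hi, hx])⟩
        · obtain ⟨x', rfl⟩ := (har Z x).2 ⟨y, hx.symm⟩
          exact Or.inr ⟨x', hj Z (by rw [hsM, hx])⟩
      inter := fun Z x y hxy => by
        obtain ⟨b, hb, hb'⟩ := h.inter Z x (a.app Z y) (by rw [← hi, ← hsM, hxy])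
        exact ⟨b, hb, ha Z (by rw [hc', hb'])⟩ }
  have hHu : IsUnion r.right c' nH sH :=
    { comm := fun Z x => hg Z (by rw [hnH, hsH, hc', h'.comm])
      inj_left := OHom.Inj.of_comp h'.inj_left hnH
      inj_right := fun Z x y hxy => ha Z (h'.inj_right Z (by rw [← hsH, ← hsH, hxy]))
      cover := fun Z y => by
        rcases (hgr Z _).1 ⟨y, rfl⟩ with ⟨x, hx⟩ | ⟨x, hx⟩
        · exact Or.inl ⟨x, hg Z (by rw [hnH, hx])⟩
        · exact Or.inr ⟨x, hg Z (by rw [hsH]; exact hx)⟩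
      inter := fun Z x y hxy => by
        obtain ⟨b, hb, hb'⟩ := h'.inter Z x (a.app Z y) (by rw [← hnH, ← hsH, hxy])
        exact ⟨b, hb, ha Z (by rw [hc', hb'])⟩ }
  obtain ⟨e, k, hel, hei, hext, hinj, hk, hk'⟩ := exists_extension r hMu hHu
  rw [hel] at hinj hk
  -- `D₀` lies in `D`: what is outside `M` is outside `L`, and the boundary of `M` comes from `D'`
  -- by the extension.
  obtain ⟨v, hv⟩ := d.exists_lift s h.inj_right (by
    intro Z z
    rcases (hdr Z _).1 ⟨z, rfl⟩ with hz | ⟨x, hx⟩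
    · rcases h.cover Z (d.app Z z) with ⟨x, hx⟩ | hx
      · exact (hz ⟨i.app Z x, by rw [hi, hx]⟩).elim
      · exact hx
    · exact ⟨a.app Z (k.app Z x), by rw [← hsM, hk, hx]⟩)
  have comm : ∀ Z x, g.app Z (e.right.app Z x) = s'.app Z (v.app Z (c₀.app Z x)) := by
    intro Z x
    have h₁ : v.app Z (c₀.app Z x) = a.app Z (k.app Z x) :=
      h.inj_right Z (by rw [hv, hc₀, ← hsM, hk])
    rw [h₁, ← hk', hsH]
  have inter : ∀ Z x z, g.app Z x = s'.app Z (v.app Z z) → d.app Z z ∈ Set.range (j.app Z) →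
      ∃ y, e.right.app Z y = x ∧ c₀.app Z y = z := by
    intro Z x z hxz hz
    rcases (hdr Z _).1 ⟨z, rfl⟩ with hz' | ⟨y, hy⟩
    · exact (hz' hz).elim
    · obtain rfl : c₀.app Z y = z := hd Z (by rw [hc₀, hy])
      exact ⟨y, hg Z (by rw [comm, hxz]), rfl⟩
  refine ⟨H, e, g, v.comp s' h'.inj_right, hel, hei, hext, hinj hM, comm, hg,
    (OHom.Inj.of_comp hd hv).comp h'.inj_right, fun Z y => ?_, fun Z x z hxz => ?_⟩
  · rcases h'.cover Z y with ⟨x, rfl⟩ | ⟨x, rfl⟩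
    · exact Or.inl ⟨nH.app Z x, hnH Z x⟩
    · by_cases hx : s.app Z x ∈ Set.range (j.app Z)
      · obtain ⟨x, rfl⟩ := (har Z x).2 hx
        exact Or.inl ⟨sH.app Z x, hsH Z x⟩
      · obtain ⟨z, hz⟩ := (hdr Z _).2 (Or.inl hx)
        have h₁ : v.app Z z = x := h.inj_right Z (by rw [hv, hz])
        exact Or.inr ⟨z, congrArg (s'.app Z) h₁⟩
  -- A common element of `H` and `D₀` lies in `M` when viewed in `G`: from `R` it must come from
  -- `B`, hence from `L`; from `D'` it is in `M` already.
  · refine inter Z x z hxz ?_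
    rw [OHom.comp_app] at hxz
    rcases hHu.cover Z x with ⟨y, rfl⟩ | ⟨y, rfl⟩
    · rw [hnH] at hxz
      obtain ⟨b, -, hb⟩ := h'.inter Z _ _ hxz
      exact ⟨i.app Z (r.left.app Z b), by rw [hi, h.comm, hb, hv]⟩
    · rw [hsH] at hxz
      have h₁ := h'.inj_right Z hxz
      exact ⟨sM.app Z y, by rw [hsM, h₁, hv]⟩

/-! ### Merging of two subgraphs -/

/-- Two subgraphs of an open-graph are boundary coherent along their intersection, and their union
is their merging. -/
theorem exists_merging {A B G : OGraph.{u}} {f : OHom A G} {g : OHom B G} (hf : f.Inj)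
    (hg : g.Inj) :
    ∃ (K : OGraph.{u}) (k₁ : OHom K A) (k₂ : OHom K B) (M : OGraph.{u}) (i₁ : OHom A M)
      (i₂ : OHom B M) (j : OHom M G), IsMerging k₁ k₂ i₁ i₂ ∧ j.Inj ∧
      (∀ Z x, j.app Z (i₁.app Z x) = f.app Z x) ∧ (∀ Z x, j.app Z (i₂.app Z x) = g.app Z x) ∧
      (∀ Z y, (∃ x, i₁.app Z x = y) ∨ ∃ x, i₂.app Z x = y) := by
  obtain ⟨K, k₁, hk₁, hr⟩ := f.exists_preimage g
  obtain ⟨k₂, hk₂⟩ := (k₁.comp f hf).exists_lift g hg (fun Z x => (hr Z _).1 ⟨x, rfl⟩)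
  simp only [OHom.comp_app] at hk₂
  obtain ⟨M, j, hj, hjr⟩ := f.exists_union g
  obtain ⟨i₁, hi₁⟩ := f.exists_lift j hj (fun Z x => (hjr Z _).2 (Or.inl ⟨x, rfl⟩))
  obtain ⟨i₂, hi₂⟩ := g.exists_lift j hj (fun Z x => (hjr Z _).2 (Or.inr ⟨x, rfl⟩))
  have hk₂i : k₂.Inj := fun Z x y hxy => hk₁ Z (hf Z (by rw [← hk₂, ← hk₂, hxy]))
  have hu : IsUnion k₁ k₂ i₁ i₂ :=
    { comm := fun Z x => hj Z (by rw [hi₁, hi₂, hk₂])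
      inj_left := OHom.Inj.of_comp hf hi₁
      inj_right := OHom.Inj.of_comp hg hi₂
      cover := fun Z y => by
        rcases (hjr Z _).1 ⟨y, rfl⟩ with ⟨x, hx⟩ | ⟨x, hx⟩
        · exact Or.inl ⟨x, hj Z (by rw [hi₁, hx])⟩
        · exact Or.inr ⟨x, hj Z (by rw [hi₂, hx])⟩
      inter := fun Z x y hxy => by
        have h₁ : f.app Z x = g.app Z y := by rw [← hi₁, ← hi₂, hxy]
        obtain ⟨z, rfl⟩ := (hr Z x).2 ⟨y, h₁.symm⟩
        exact ⟨z, rfl, hg Z (by rw [hk₂, h₁])⟩ }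
  have coherent : ∀ (φ : WalkingParallelPair.zero ⟶ WalkingParallelPair.one),
      ∀ p ∈ K.free φ, k₁.onPoint p ∈ A.free φ ∨ k₂.onPoint p ∈ B.free φ := by
    intro φ p hp
    by_contra hcon
    have h₁ : ∃ e, A.typed.left.map φ e = k₁.app _ p := by
      by_contra! hno
      exact hcon (Or.inl ⟨(k₁.isEdgePoint_iff p).2 hp.1, hno⟩)
    have h₂ : ∃ e, B.typed.left.map φ e = k₂.app _ p := by
      by_contra! hno
      exact hcon (Or.inr ⟨(k₂.isEdgePoint_iff p).2 hp.1, hno⟩)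
    obtain ⟨x, hx⟩ := h₁
    obtain ⟨y, hy⟩ := h₂
    have h₃ : f.app _ x = g.app _ y :=
      OGraph.edge_eq_of_end_eq (p := f.app _ (k₁.app _ p)) φ
        ((f.isEdgePoint_iff _).2 ((k₁.isEdgePoint_iff p).2 hp.1))
        (by rw [← f.app_map, hx]) (by rw [← g.app_map, hy, hk₂])
    obtain ⟨z, rfl⟩ := (hr _ x).2 ⟨y, h₃.symm⟩
    -- The shared edge lies in the intersection `K`, so `p` was not free there.
    exact hp.2 z (hk₁ _ ((k₁.app_map φ z).trans hx))
  exact ⟨K, k₁, k₂, M, i₁, i₂, j, ⟨⟨hk₁.isMono, hk₂i.isMono, coherent _, coherent _⟩,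
    hu.isAdhesivePushout hk₁⟩, hj, hi₁, hi₂, hu.cover⟩

end OpenGraph

/-! ### Composition of the two rewrites -/

open OpenGraph

theorem mainTheorem9
    {L₁ B₁ R₁ L₂ B₂ R₂ M₁ M₂ M₃ C₁ C₂ : OpenGraph.OGraph.{u}}
    (r₁ : OpenGraph.RewriteRule L₁ B₁ R₁) (r₂ : OpenGraph.RewriteRule L₂ B₂ R₂)
    (m₁ : OpenGraph.OHom L₁ M₁) (m₂ : OpenGraph.OHom L₂ M₂)
    (e₁ : OpenGraph.BoundarySpan M₁ C₁ M₂) (e₂ : OpenGraph.BoundarySpan M₂ C₂ M₃)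
    (h₁ : OpenGraph.IsExtension r₁ m₁ e₁) (h₂ : OpenGraph.IsExtension r₂ m₂ e₂) :
    ∃ (K : OpenGraph.OGraph.{u}) (k₁ : OpenGraph.OHom K R₁) (k₂ : OpenGraph.OHom K L₂)
      (G B G' : OpenGraph.OGraph.{u}) (q : OpenGraph.RewriteRule G B G')
      (m' : OpenGraph.OHom G M₁)
      (C : OpenGraph.OGraph.{u}) (e : OpenGraph.BoundarySpan M₁ C M₃),
      OpenGraph.IsSeqComp r₁ r₂ k₁ k₂ q ∧
      OpenGraph.IsExtension q m' e ∧
      (e₁.IsRule → e₂.IsRule → e.IsRule) := by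
  obtain ⟨D₁, c₁, s₁, n₁, s₁', hu₁, hu₁'⟩ := h₁.exists_isUnion
  obtain ⟨D₂, c₂, s₂, n₂, s₂', hu₂, hu₂'⟩ := h₂.exists_isUnion
  obtain ⟨K, k₁, k₂, M, i₁, i₂, j, hmerge, hj, hi₁, hi₂, hcov⟩ :=
    exists_merging hu₁'.inj_left hu₂.inj_left
  -- An isolated edge-point of `M` would come from one in `R₁` or `L₂`, which have none because the
  -- legs of the rules are mono.
  have hM : M.bdMap.Inj := by
    rw [M.isBoundaryMap_bdMap.inj_iff, Set.disjoint_left]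
    intro p hp hp'
    rcases hcov _ p with ⟨x, rfl⟩ | ⟨x, rfl⟩
    · exact Set.disjoint_left.1 (r₁.isBoundary_right.inj_iff.1
        (r₁.isRule.2.inj_of_isPointGraph r₁.isBoundary_right.pointGraph))
        (i₁.mem_free_of_app_mem hp) (i₁.mem_free_of_app_mem hp')
    · exact Set.disjoint_left.1 (r₂.isBoundary_left.inj_iff.1
        (r₂.isRule.1.inj_of_isPointGraph r₂.isBoundary_left.pointGraph))
        (i₂.mem_free_of_app_mem hp) (i₂.mem_free_of_app_mem hp')
  obtain ⟨D₀, d, hd, hdr⟩ := j.exists_complement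
  obtain ⟨c₀, hc₀⟩ := (M.bdMap.comp j hj).exists_lift d hd
    (fun Z x => (hdr Z _).2 (Or.inr ⟨x, rfl⟩))
  obtain ⟨G, f₁, g₁, t₁, hl₁, hs₁, hx₁, hr₁, hw₁⟩ :=
    exists_restriction r₁.op hu₁' hu₁ hj hi₁ hM hd hdr hc₀
  obtain ⟨G', f₂, g₂, t₂, hl₂, hs₂, hx₂, hr₂, hw₂⟩ :=
    exists_restriction r₂ hu₂ hu₂' hj hi₂ hM hd hdr hc₀
  let q : RewriteRule G M.bd G' :=
    { left := f₁.right
      right := f₂.right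
      ins := M.bdIns
      isBoundary_left := hs₁ ▸ f₁.isBoundary_right
      isBoundary_right := hs₂ ▸ f₂.isBoundary_right
      isRule := ⟨hr₁.isMono, hr₂.isMono⟩ }
  -- `hw₁` and `hw₂` share `c₀`, so they form the double pushout of `q`.
  obtain ⟨e, k, hel, -, hext, hinj, -⟩ := exists_extension q hw₁ hw₂
  refine ⟨K, k₁, k₂, G, M.bd, G', q, g₁, M₁.bd, e, ⟨M, i₁, i₂, f₁, f₂, hmerge, hx₁, hx₂,
    hl₁.trans hl₂.symm, hs₁.trans hs₂.symm, rfl, rfl, hs₁.symm⟩, hext, fun he₁ _ => ?_⟩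
  -- Both `e.left` and `e₁.left` are boundary maps of `M₁`, so injectivity transfers.
  have hleft : e.left.Inj := e.isBoundary_left.inj_iff.2 (e₁.isBoundary_left.inj_iff.1
    (he₁.1.inj_of_isPointGraph e₁.isBoundary_left.pointGraph))
  exact ⟨hleft.isMono, (hinj hleft).isMono⟩
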